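/- Let $d\ge 1$, let $\|\cdot\|$ be the Euclidean norm on $\mathbb{R}^d$, and let $\{W(\mathbf x)\}_{\mathbf x\in\mathbb{R}^d}$ be a separable (in Doob's sense) centred Gaussian random field on a probability space $(\Omega,\mathcal F,\mathbb P)$, with stationary increments (the finite-dimensional distributions of $\{W(\mathbf x+\mathbf x_0)-W(\mathbf x_0)\}_{\mathbf x\in\mathbb{R}^d}$ do not depend on $\mathbf x_0\in\mathbb{R}^d$) and with $W(\mathbf 0)=0$ almost surely. Here separable means that there are a countable dense set $D\subset\mathbb{R}^d$ and a null event $N$ such that for every $\omega\notin N$, every open $U\subset\mathbb{R}^d$ and every closed $C\subset\mathbb{R}$, if $W(\mathbf y,\omega)\in C$ for all $\mathbf y\in U\cap D$, then $W(\mathbf x,\omega)\in C$ for all $\mathbf x\in U$. Write $\sigma_W^2(\mathbf x)=\mathrm{Var}(W(\mathbf x))$. Assume that $W$ is almost surely bounded on $[0,1]^d$ and that, as $\|\mathbf h\|\to\infty$ with $\mathbf h\in\mathbb{Z}^d$, $$\sup_{\mathbf x\in[0,1]^d}\{\sigma_W^2(\mathbf h)-\sigma_W^2(\mathbf x+\mathbf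 h)\}=o(\sigma_W^2(\mathbf h))\qquad\text{and}\qquad \frac{\sigma_W^2(\mathbf h)}{\ln\|\mathbf h\|}\to\infty .$$ Let $Y(\mathbf x)=\exp\left(W(\mathbf x)-\sigma_W^2(\mathbf x)/2\right)$, $\mathbf x\in\mathbb{R}^d$. Then for every $b>0$ there is a constant $K>0$ such that, for all $\mathbf h\in\mathbb{Z}^d\setminus\{\mathbf 0\}$, $$\mathbb{E}\left[\min\left\{\sup_{\mathbf x\in[0,1]^d}Y(\mathbf x),\ \sup_{\mathbf x\in[\mathbf h,\mathbf h+1]}Y(\mathbf x)\right\}\right]\le K\|\mathbf h\|^{-b},$$ where $[\mathbf h,\mathbf h+1]=\prod_{i=1}^d[h_i,h_i+1]$ and $\mathbb{E}$ is read as the outer expectation (the infimum of the expectations of measurable majorants) if the minimum is not measurable. -/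

import Mathlib

open MeasureTheory ProbabilityTheory Filter Topology Asymptotics
open scoped ENNReal

/-- `ℝ^d` with the Euclidean norm. -/
abbrev Space (d : ℕ) : Type := EuclideanSpace ℝ (Fin d)

/-- The point of `ℝ^d` with integer coordinates `h`. -/
noncomputable def latticePoint {d : ℕ} (h : Fin d → ℤ) : Space d :=
  WithLp.toLp 2 (fun i => (h i : ℝ))

/-- The closed unit cube `[h, h + 1] = ∏ i, [h i, h i + 1]`; `unitCube 0` is `[0,1]^d`. -/
def unitCube {d : ℕ} (h : Fin d → ℤ) : Set (Space d) :=
  {x | ∀ i, (h i : ℝ) ≤ x i ∧ x i ≤ (h i : ℝ) + 1}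

/-- The filter `‖h‖ → ∞` on `ℤ^d`. -/
noncomputable def latticeAtInfinity (d : ℕ) : Filter (Fin d → ℤ) :=
  comap (fun h => ‖latticePoint h‖) atTop

section RandomFields

variable {Ω : Type*} [MeasurableSpace Ω] {d : ℕ}

/-- Stationary increments: the finite-dimensional distributions of
`x ↦ W (x + x₀) - W x₀` do not depend on `x₀`. -/
def HasStationaryIncrements (W : Space d → Ω → ℝ) (P : Measure Ω) : Prop :=
  ∀ (x₀ x₁ : Space d) (I : Finset (Space d)),
    IdentDistrib (fun ω (x : I) => W ((x : Space d) + x₀) ω - W x₀ ω)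
      (fun ω (x : I) => W ((x : Space d) + x₁) ω - W x₁ ω) P P

/-- Separability in the sense of Doob: there is a countable dense set `D` such that, outside one
null event, for all open `U ⊆ ℝ^d` and closed `C ⊆ ℝ`, the path takes its values in `C`
on all of `U` as soon as it does so on `U ∩ D`. -/
def IsSeparableField (W : Space d → Ω → ℝ) (P : Measure Ω) : Prop :=
  ∃ D : Set (Space d), D.Countable ∧ Dense D ∧
    ∀ᵐ ω ∂P, ∀ (U : Set (Space d)) (C : Set ℝ), IsOpen U → IsClosed C →
      (∀ y ∈ U ∩ D, W y ω ∈ C) → ∀ x ∈ U, W x ω ∈ C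

/-- The variance function `σ_W²`. -/
noncomputable def fieldVariance (W : Space d → Ω → ℝ) (P : Measure Ω) (x : Space d) : ℝ :=
  variance (W x) P

/-- The field `Y(x) = exp (W(x) - σ_W²(x) / 2)`. -/
noncomputable def brownResnickSpectral (W : Space d → Ω → ℝ) (P : Measure Ω) :
    Space d → Ω → ℝ :=
  fun x ω => Real.exp (W x ω - fieldVariance W P x / 2)

/-- The supremum in `[0, ∞]` of the nonnegative field `Y` over the set `A`. -/
noncomputable def fieldSup (Y : Space d → Ω → ℝ) (A : Set (Space d)) (ω : Ω) : ℝ≥0∞ :=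
  ⨆ x ∈ A, ENNReal.ofReal (Y x ω)

/-- The (outer) expectation of a `[0, ∞]`-valued function: the infimum of the expectations of
its measurable majorants. For measurable functions it is the usual expectation
(`outerExpectation_eq_lintegral`). -/
noncomputable def outerExpectation (P : Measure Ω) (f : Ω → ℝ≥0∞) : ℝ≥0∞ :=
  ⨅ (g : Ω → ℝ≥0∞) (_ : Measurable g) (_ : ∀ᵐ ω ∂P, f ω ≤ g ω), ∫⁻ ω, g ω ∂P

theorem outerExpectation_eq_lintegral (P : Measure Ω) (f : Ω → ℝ≥0∞) (hf : AEMeasurable f P) :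
    outerExpectation P f = ∫⁻ ω, f ω ∂P := by
  refine le_antisymm ?_ ?_
  · refine (iInf₂_le_of_le (hf.mk f) hf.measurable_mk (iInf_le _ ?_)).trans_eq
      (lintegral_congr_ae hf.ae_eq_mk.symm)
    exact hf.ae_eq_mk.le
  · exact le_iInf fun g => le_iInf fun _ => le_iInf fun h => lintegral_mono_ae h

/-- The decay condition with exponent `b`: for some `K > 0`,
`E[min {sup_{[0,1]^d} Y, sup_{[h,h+1]} Y}] ≤ K ‖h‖^{-b}` for all `h ∈ ℤ^d`; at `h = 0` the
right-hand side is infinite and nothing is claimed. -/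
def SatisfiesDecay (Y : Space d → Ω → ℝ) (P : Measure Ω) (b : ℝ) : Prop :=
  ∃ K : ℝ, 0 < K ∧ ∀ h : Fin d → ℤ, h ≠ 0 →
    outerExpectation P (fun ω => min (fieldSup Y (unitCube 0) ω) (fieldSup Y (unitCube h) ω)) ≤
      ENNReal.ofReal (K * ‖latticePoint h‖ ^ (-b))

end RandomFields

/-!
The proof rests on a decomposition at the corner of the far cube. For `y ∈ [h, h + 1]`,
`Y(y) ≤ exp (W(h) - inf σ_W² / 2) * exp |W(y) - W(h)|`, where the infimum is over `[h, h + 1]`.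
The second factor has, by stationarity of the increments, the same supremum in law as
`exp |W|` on the unit cube. By Fernique's theorem all exponential moments of that supremum are
finite. By the first variance condition the infimum is at least `3/4 σ_W²(h)` far out, so the
square root of the first factor has expectation at most `exp (σ_W²(h)/8 - 3σ_W²(h)/16)`: it decays
exponentially in `σ_W²(h)`. The minimum of the two suprema can only be large if the first factor
exceeds `exp (-σ_W²(h)/64)`, which is an unlikely event by the above
(`min_le_of_le_mul`, `exists_outerExpectation_min_le`). Hence the expectation is at most a constant
times `exp (-σ_W²(h)/64)`, and the second variance condition turns this into decay faster than
every power of `‖h‖`.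

Two points need care. Fernique's theorem is applied to a countable family rather than to a Gaussian
measure on a separable Banach space: the bound for finite subfamilies depends only on a quantile of
the supremum, so it passes to the limit (`lintegral_expSup_lt_top`). The suprema over closed cubes
are controlled through the separating set `D`, which is enlarged to be invariant under `ℤ^d`; since
separability speaks of open sets, the cube `(-1, 2)^d` takes the place of `[0,1]^d`, and boundedness
on it follows from boundedness on `[0,1]^d` and stationarity (`ae_exists_bound_bigCube`).
-/

/-! ### Exponential suprema of countable Gaussian families -/

/-- The exponential supremum `⨆ i, exp (2 |v i|)` of a family of reals, as an element of
`[0, ∞]`. It is finite exactly when the family is bounded. -/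
noncomputable def expSup {ι : Type*} (v : ι → ℝ) : ℝ≥0∞ :=
  ⨆ i, ENNReal.ofReal (Real.exp (2 * |v i|))

theorem le_expSup {ι : Type*} (v : ι → ℝ) (i : ι) :
    ENNReal.ofReal (Real.exp (2 * |v i|)) ≤ expSup v :=
  le_iSup (fun i => ENNReal.ofReal (Real.exp (2 * |v i|))) i

theorem measurable_expSup {ι : Type*} [Countable ι] :
    Measurable (expSup : (ι → ℝ) → ℝ≥0∞) := by
  unfold expSup
  refine Measurable.iSup fun i => ?_
  have : Measurable fun v : ι → ℝ => v i := measurable_pi_apply i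
  fun_prop

theorem expSup_lt_top {ι : Type*} {v : ι → ℝ} {M : ℝ} (h : ∀ i, |v i| ≤ M) : expSup v < ∞ := by
  refine lt_of_le_of_lt (iSup_le fun i => ?_) (ENNReal.ofReal_lt_top (r := Real.exp (2 * M)))
  gcongr
  exact h i

theorem exists_abs_le_of_expSup_lt_top {ι : Type*} {v : ι → ℝ} (h : expSup v < ∞) :
    ∃ M : ℝ, ∀ i, |v i| ≤ M := by
  refine ⟨(expSup v).toReal, fun i => ?_⟩
  have h1 : Real.exp (2 * |v i|) ≤ (expSup v).toReal :=
    (ENNReal.ofReal_le_iff_le_toReal h.ne).1 (le_expSup v i)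
  linarith [Real.add_one_le_exp (2 * |v i|), abs_nonneg (v i)]

theorem expSup_eq_iSup_finset {ι : Type*} (v : ι → ℝ) :
    expSup v = ⨆ F : Finset ι, expSup (fun i : F => v i) := by
  refine le_antisymm (iSup_le fun i => ?_) (iSup_le fun F => iSup_le fun i => le_expSup v i)
  exact le_iSup_of_le {i} (le_expSup (fun j : ({i} : Finset ι) => v j) ⟨i, by simp⟩)

/-- Fernique's bound for finite centred Gaussian vectors with the supremum norm: if the vector has
norm at most `a` with probability at least `3/4`, then its exponential moment is bounded by a
quantity depending on `a` alone, in particular not on the dimension. -/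
theorem exists_lintegral_expSup_le_of_finite {Ω : Type*} [MeasurableSpace Ω] (P : Measure Ω)
    [IsProbabilityMeasure P] {a : ℝ} (ha : 0 < a) :
    ∃ K : ℝ≥0∞, K < ∞ ∧ ∀ (ι : Type _) [Fintype ι] (X : ι → Ω → ℝ),
      HasGaussianLaw (fun ω i => X i ω) P → (∀ i, ∫ ω, X i ω ∂P = 0) →
      3 / 4 ≤ P {ω | ∀ i, |X i ω| ≤ a} → ∫⁻ ω, expSup (fun i => X i ω) ∂P ≤ K := by
  set c : ℝ≥0∞ := 3 / 4 with hc
  have hcr : c = ENNReal.ofReal (3 / 4) := by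
    rw [hc, ENNReal.ofReal_div_of_pos (by norm_num)]; norm_num
  have hc_gt : 2⁻¹ < c := by
    rw [hcr, ← ENNReal.ofReal_ofNat, ← ENNReal.ofReal_inv_of_pos (by norm_num)]
    exact (ENNReal.ofReal_lt_ofReal_iff (by norm_num)).2 (by norm_num)
  have hc_lt : c < 1 := by
    rw [hcr, ← ENNReal.ofReal_one]
    exact (ENNReal.ofReal_lt_ofReal_iff (by norm_num)).2 (by norm_num)
  have hratio : (c / (1 - c)).toReal = 3 := by
    rw [hcr, ← ENNReal.ofReal_one, ← ENNReal.ofReal_sub _ (by norm_num),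
      ← ENNReal.ofReal_div_of_pos (by norm_num), ENNReal.toReal_ofReal (by norm_num)]
    norm_num
  set C : ℝ := Fernique.logRatio c * a⁻¹ ^ 2 with hC
  have hCpos : 0 < C := mul_pos (Fernique.logRatio_pos hc_gt hc_lt) (by positivity)
  set K : ℝ≥0∞ := ENNReal.ofReal (Real.exp (Fernique.logRatio c))
        + ∑' n : ℕ, ENNReal.ofReal
          (Real.exp (-2⁻¹ * Real.log (c / (1 - c)).toReal * 2 ^ n)) with hK
  have hKtop : K < ∞ := by
    refine ENNReal.add_lt_top.mpr ⟨ENNReal.ofReal_lt_top, ?_⟩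
    refine Summable.tsum_ofReal_lt_top <|
      Real.summable_exp_nat_mul_of_ge ?_ (fun i => mod_cast (Nat.lt_pow_self (by simp)).le)
    rw [hratio]
    exact mul_neg_of_neg_of_pos (by simp) (Real.log_pos (by norm_num))
  refine ⟨ENNReal.ofReal (Real.exp C⁻¹) * K, ENNReal.mul_lt_top ENNReal.ofReal_lt_top hKtop, ?_⟩
  intro ι _ X hX h0 hle
  have hXm : AEMeasurable (fun ω i => X i ω) P := hX.aemeasurable
  have := hX.isGaussian_map
  have hcent : ∀ L : StrongDual ℝ (ι → ℝ), (P.map (fun ω i => X i ω))[L] = 0 := by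
    intro L
    rw [IsGaussian.integral_dual]
    have hid : ∫ x, x ∂(P.map (fun ω i => X i ω)) = 0 := by
      rw [integral_map hXm (by fun_prop)]
      ext i
      rw [eval_integral (fun i => (hX.eval i).integrable)]
      exact h0 i
    rw [hid, map_zero]
  have hrot := IsGaussian.map_rotation_eq_self_of_forall_strongDual_eq_zero hcent (-(Real.pi / 4))
  have hmeas : c ≤ P.map (fun ω i => X i ω) {x | ‖x‖ ≤ a} := by
    rw [Measure.map_apply_of_aemeasurable hXm (measurableSet_le (by fun_prop) (by fun_prop))]
    refine hle.trans_eq (congrArg P ?_)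
    ext ω
    simp [pi_norm_le_iff_of_nonneg ha.le]
  have hF := lintegral_exp_mul_sq_norm_le_of_map_rotation_eq_self hrot hmeas hc_gt
  rw [lintegral_map' (by fun_prop) hXm] at hF
  calc ∫⁻ ω, expSup (fun i => X i ω) ∂P
      ≤ ∫⁻ ω, ENNReal.ofReal (Real.exp C⁻¹) *
          ENNReal.ofReal (Real.exp (C * ‖fun i => X i ω‖ ^ 2)) ∂P := by
        refine lintegral_mono fun ω => iSup_le fun i => ?_
        rw [← ENNReal.ofReal_mul (Real.exp_pos _).le, ← Real.exp_add]
        gcongr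
        have h1 : |X i ω| ≤ ‖fun i => X i ω‖ := norm_le_pi_norm (fun i => X i ω) i
        -- The inequality `2 s ≤ C⁻¹ + C s²`.
        have h2 : 0 ≤ C⁻¹ * (C * ‖fun i => X i ω‖ - 1) ^ 2 := by positivity
        have h3 : C⁻¹ * (C * ‖fun i => X i ω‖ - 1) ^ 2 =
            C⁻¹ + C * ‖fun i => X i ω‖ ^ 2 - 2 * ‖fun i => X i ω‖ := by
          field_simp
          ring
        linarith
    _ = ENNReal.ofReal (Real.exp C⁻¹) *
          ∫⁻ ω, ENNReal.ofReal (Real.exp (C * ‖fun i => X i ω‖ ^ 2)) ∂P :=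
        lintegral_const_mul' _ _ ENNReal.ofReal_ne_top
    _ ≤ ENNReal.ofReal (Real.exp C⁻¹) * K := by gcongr

/-- Fernique's theorem for countable families: the exponential supremum of an almost surely bounded
centred Gaussian process over a countable index set is integrable. The finite-dimensional bound is
uniform over finite subfamilies, so it passes to the supremum by monotone convergence. -/
theorem lintegral_expSup_lt_top {Ω ι : Type*} [MeasurableSpace Ω] [Countable ι] {P : Measure Ω}
    [IsProbabilityMeasure P] {X : ι → Ω → ℝ} (hX : IsGaussianProcess X P)
    (h0 : ∀ i, ∫ ω, X i ω ∂P = 0) (hb : ∀ᵐ ω ∂P, ∃ M : ℝ, ∀ i, |X i ω| ≤ M) :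
    ∫⁻ ω, expSup (fun i => X i ω) ∂P < ∞ := by
  obtain ⟨a, ha, hPa⟩ : ∃ a : ℝ, 0 < a ∧ 3 / 4 ≤ P {ω | ∀ i, |X i ω| ≤ a} := by
    have hmono : Monotone fun n : ℕ => {ω | ∀ i, |X i ω| ≤ (n : ℝ)} := fun m n hmn ω hω i =>
      (hω i).trans (by exact_mod_cast hmn)
    have hlim := tendsto_measure_iUnion_atTop (μ := P) hmono
    have huniv : P (⋃ n : ℕ, {ω | ∀ i, |X i ω| ≤ (n : ℝ)}) = 1 := by
      rw [← measure_univ (μ := P)]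
      refine measure_congr (eventuallyEq_univ.2 ?_)
      filter_upwards [hb] with ω ⟨M, hM⟩
      obtain ⟨n, hn⟩ := exists_nat_ge M
      exact Set.mem_iUnion.2 ⟨n, fun i => (hM i).trans hn⟩
    rw [huniv] at hlim
    have h34 : (3 / 4 : ℝ≥0∞) < 1 := by
      rw [ENNReal.div_lt_iff (by simp) (by simp)]; norm_num
    obtain ⟨n, hn, hn1⟩ := ((hlim.eventually (lt_mem_nhds h34)).and (eventually_ge_atTop 1)).exists
    exact ⟨n, by exact_mod_cast hn1, hn.le⟩
  obtain ⟨K, hK, hbound⟩ := exists_lintegral_expSup_le_of_finite P ha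
  refine lt_of_le_of_lt ?_ hK
  have hmeas (F : Finset ι) : AEMeasurable (fun ω => expSup (fun i : F => X i ω)) P :=
    measurable_expSup.comp_aemeasurable (aemeasurable_pi_lambda _ fun i => hX.aemeasurable i)
  have hdir : Directed (· ≤ ·) fun (F : Finset ι) ω => expSup (fun i : F => X i ω) := by
    refine Monotone.directed_le fun F G hFG ω => iSup_le fun i => ?_
    exact le_expSup (fun i : G => X i ω) ⟨i, hFG i.2⟩
  simp_rw [fun ω => expSup_eq_iSup_finset (fun i => X i ω)]
  rw [lintegral_iSup_directed hmeas hdir]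
  refine iSup_le fun F => hbound F (fun i => X i) (hX.hasGaussianLaw F) (fun i => h0 i) ?_
  exact hPa.trans (measure_mono fun ω hω i => hω i)
/-! ### Lattice translates -/

section Lattice

variable {d : ℕ}

@[simp]
theorem latticePoint_apply (h : Fin d → ℤ) (i : Fin d) : latticePoint h i = (h i : ℝ) := rfl

theorem latticePoint_zero : latticePoint (0 : Fin d → ℤ) = 0 := by
  ext i; simp

theorem latticePoint_add (h k : Fin d → ℤ) :
    latticePoint (h + k) = latticePoint h + latticePoint k := by
  ext i; simp

theorem one_le_norm_latticePoint {h : Fin d → ℤ} (hh : h ≠ 0) : 1 ≤ ‖latticePoint h‖ := by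
  obtain ⟨i, hi⟩ := Function.ne_iff.1 hh
  have h1 : (1 : ℝ) ≤ |(h i : ℝ)| := by exact_mod_cast Int.one_le_abs hi
  exact h1.trans (by simpa using PiLp.norm_apply_le (latticePoint h) i)

/-- The open cube `(-1, 2)^d`, a neighbourhood of `[0,1]^d` covered by finitely many of its
lattice translates. -/
def bigCube (d : ℕ) : Set (Space d) := {x | ∀ i, -1 < x i ∧ x i < 2}

theorem isOpen_bigCube : IsOpen (bigCube d) := by
  have : bigCube d = ⋂ i : Fin d, {x : Space d | -1 < x i ∧ x i < 2} := by
    ext x; simp [bigCube]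
  rw [this]
  refine isOpen_iInter_of_finite fun i => ?_
  have hc : Continuous fun x : Space d => x i := by fun_prop
  exact (isOpen_lt continuous_const hc).inter (isOpen_lt hc continuous_const)

theorem unitCube_zero_subset_bigCube : unitCube (0 : Fin d → ℤ) ⊆ bigCube d := by
  intro x hx i
  have := hx i
  simp only [Pi.zero_apply, Int.cast_zero] at this
  constructor <;> linarith

theorem sub_latticePoint_mem_unitCube {h : Fin d → ℤ} {x : Space d} (hx : x ∈ unitCube h) :
    x - latticePoint h ∈ unitCube (0 : Fin d → ℤ) := by
  intro i
  have := hx i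
  simp only [PiLp.sub_apply, latticePoint_apply, Pi.zero_apply, Int.cast_zero]
  constructor <;> linarith

theorem exists_mem_unitCube_of_mem_bigCube {x : Space d} (hx : x ∈ bigCube d) :
    ∃ k : Fin d → ℤ, k ∈ Set.Icc (-1 : Fin d → ℤ) 1 ∧ x ∈ unitCube k := by
  refine ⟨fun i => ⌊x i⌋, ⟨fun i => ?_, fun i => ?_⟩,
    fun i => ⟨Int.floor_le _, (Int.lt_floor_add_one _).le⟩⟩
  · exact Int.le_floor.2 (by simpa using (hx i).1.le)
  · have h1 : ⌊x i⌋ < 2 := Int.floor_lt.2 (by simpa using (hx i).2)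
    change ⌊x i⌋ ≤ 1
    omega

end Lattice

/-! ### The field on lattice translates of the unit cube -/

section Field

variable {Ω : Type*} [MeasurableSpace Ω] {d : ℕ} {P : Measure Ω} {W : Space d → Ω → ℝ}

/-- The separating set may be taken invariant under lattice translations: any larger countable set
separates as well. -/
theorem IsSeparableField.exists_invariant (hSep : IsSeparableField W P) :
    ∃ D : Set (Space d), D.Countable ∧
      (∀ x ∈ D, ∀ k : Fin d → ℤ, x + latticePoint k ∈ D) ∧
      ∀ᵐ ω ∂P, ∀ (U : Set (Space d)) (C : Set ℝ), IsOpen U → IsClosed C →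
        (∀ y ∈ U ∩ D, W y ω ∈ C) → ∀ x ∈ U, W x ω ∈ C := by
  obtain ⟨D, hDc, -, hD⟩ := hSep
  refine ⟨⋃ k : Fin d → ℤ, (fun x => x + latticePoint k) ⁻¹' D, ?_, ?_, ?_⟩
  · exact Set.countable_iUnion fun k => hDc.preimage_of_injOn (add_left_injective _).injOn
  · intro x hx k
    obtain ⟨j, hj⟩ := Set.mem_iUnion.1 hx
    refine Set.mem_iUnion.2 ⟨j - k, ?_⟩
    have : x + latticePoint k + latticePoint (j - k) = x + latticePoint j := by
      rw [add_assoc, ← latticePoint_add, add_sub_cancel]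
    simpa [this] using hj
  · filter_upwards [hD] with ω hω U C hU hC hUC
    refine hω U C hU hC fun y hy => hUC y ⟨hy.1, Set.mem_iUnion.2 ⟨0, ?_⟩⟩
    simpa [latticePoint_zero] using hy.2

/-- Stationary increments on a countable index set: the whole family of increments from `x₀` has
the law of the field itself. -/
theorem HasStationaryIncrements.identDistrib [IsProbabilityMeasure P]
    (hIncr : HasStationaryIncrements W P) (hm : ∀ x, AEMeasurable (W x) P)
    (hZero : ∀ᵐ ω ∂P, W 0 ω = 0) (x₀ : Space d) {S : Set (Space d)} (hS : S.Countable) :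
    IdentDistrib (fun ω (q : S) => W (q + x₀) ω - W x₀ ω) (fun ω (q : S) => W q ω) P P := by
  have := hS.to_subtype
  have h1 : AEMeasurable (fun ω (q : S) => W (q + x₀) ω - W x₀ ω) P :=
    aemeasurable_pi_lambda _ fun q => (hm _).sub (hm _)
  have h2 : AEMeasurable (fun ω (q : S) => W (q + 0) ω - W 0 ω) P :=
    aemeasurable_pi_lambda _ fun q => (hm _).sub (hm _)
  have h3 : IdentDistrib (fun ω (q : S) => W (q + x₀) ω - W x₀ ω)
      (fun ω (q : S) => W (q + 0) ω - W 0 ω) P P := by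
    rw [identDistrib_iff_forall_finset_identDistrib (X := fun (q : S) ω => W (q + x₀) ω - W x₀ ω)
      (Y := fun (q : S) ω => W (q + 0) ω - W 0 ω) h1 h2]
    intro I
    have hI := hIncr x₀ 0 (I.map (Function.Embedding.subtype _))
    exact hI.comp (u := fun v (i : I) =>
      v ⟨(i : S), Finset.mem_map_of_mem (Function.Embedding.subtype _) i.2⟩) (by fun_prop)
  refine h3.trans (IdentDistrib.of_ae_eq h2 ?_)
  filter_upwards [hZero] with ω hω
  ext q
  simp [hω]

/-- The field is almost surely bounded on the trace of a countable lattice-invariant set on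
`(-1, 2)^d`. Boundedness on `[0,1]^d` is transported to the neighbouring cubes by
stationarity of the increments. -/
theorem ae_exists_bound_bigCube [IsProbabilityMeasure P]
    (hIncr : HasStationaryIncrements W P) (hm : ∀ x, AEMeasurable (W x) P)
    (hZero : ∀ᵐ ω ∂P, W 0 ω = 0)
    (hBdd : ∀ᵐ ω ∂P, ∃ M : ℝ, ∀ x ∈ unitCube (0 : Fin d → ℤ), |W x ω| ≤ M)
    {D : Set (Space d)} (hDc : D.Countable)
    (hD : ∀ x ∈ D, ∀ k : Fin d → ℤ, x + latticePoint k ∈ D) :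
    ∀ᵐ ω ∂P, ∃ M : ℝ, ∀ q : ↥(D ∩ bigCube d), |W q ω| ≤ M := by
  set S : Set (Space d) := D ∩ unitCube 0
  have hS : S.Countable := hDc.mono Set.inter_subset_left
  have := hS.to_subtype
  have hfin (k : Fin d → ℤ) : ∀ᵐ ω ∂P,
      expSup (fun q : S => W (q + latticePoint k) ω - W (latticePoint k) ω) < ∞ := by
    refine (hIncr.identDistrib hm hZero (latticePoint k) hS).symm.ae_snd
      (p := fun v => expSup v < ∞) (measurable_expSup measurableSet_Iio) ?_
    filter_upwards [hBdd] with ω ⟨M, hM⟩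
    exact expSup_lt_top fun q => hM q q.2.2
  filter_upwards [ae_all_iff.2 hfin] with ω hω
  choose M hM using fun k => exists_abs_le_of_expSup_lt_top (hω k)
  obtain ⟨B, hB⟩ := ((Set.finite_Icc (-1 : Fin d → ℤ) 1).image
    fun k => M k + |W (latticePoint k) ω|).bddAbove
  refine ⟨B, fun q => ?_⟩
  obtain ⟨k, hk, hqk⟩ := exists_mem_unitCube_of_mem_bigCube q.2.2
  have hmem : (q : Space d) - latticePoint k ∈ S := by
    refine ⟨?_, sub_latticePoint_mem_unitCube hqk⟩
    have hneg : latticePoint (-k) = -latticePoint k := by ext i; simp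
    simpa [hneg, sub_eq_add_neg] using hD q q.2.1 (-k)
  have h1 := hM k ⟨_, hmem⟩
  simp only [sub_add_cancel] at h1
  have h2 : M k + |W (latticePoint k) ω| ≤ B := hB (Set.mem_image_of_mem _ hk)
  have h3 := abs_sub_abs_le_abs_sub (W q ω) (W (latticePoint k) ω)
  linarith

/-- Separability carries the supremum of the increments over the countable set to all points of
the translated unit cube. -/
theorem ofReal_exp_le_expSup_of_separated {Ω : Type*} {W : Space d → Ω → ℝ} {D : Set (Space d)}
    (hD : ∀ x ∈ D, ∀ k : Fin d → ℤ, x + latticePoint k ∈ D) {ω : Ω}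
    (hω : ∀ (U : Set (Space d)) (C : Set ℝ), IsOpen U → IsClosed C →
        (∀ y ∈ U ∩ D, W y ω ∈ C) → ∀ x ∈ U, W x ω ∈ C)
    (h : Fin d → ℤ) {x : Space d} (hx : x ∈ unitCube h) :
    ENNReal.ofReal (Real.exp (2 * |W x ω - W (latticePoint h) ω|)) ≤
      expSup (fun q : ↥(D ∩ bigCube d) => W (q + latticePoint h) ω - W (latticePoint h) ω) := by
  refine hω ((fun x => x - latticePoint h) ⁻¹' bigCube d)
    {t | ENNReal.ofReal (Real.exp (2 * |t - W (latticePoint h) ω|)) ≤ expSup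
      (fun q : ↥(D ∩ bigCube d) => W (q + latticePoint h) ω - W (latticePoint h) ω)}
    (isOpen_bigCube.preimage (by fun_prop))
    (isClosed_le (ENNReal.continuous_ofReal.comp (by fun_prop)) continuous_const) ?_ x
    (unitCube_zero_subset_bigCube (sub_latticePoint_mem_unitCube hx))
  rintro y ⟨hyU, hyD⟩
  have hmem : y - latticePoint h ∈ D ∩ bigCube d := by
    refine ⟨?_, hyU⟩
    have hneg : latticePoint (-h) = -latticePoint h := by ext i; simp
    simpa [hneg, sub_eq_add_neg] using hD y hyD (-h)
  simpa using le_expSup (fun q : ↥(D ∩ bigCube d) =>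
    W (q + latticePoint h) ω - W (latticePoint h) ω) ⟨_, hmem⟩

/-- The exponential moment of a one-point marginal of a centred Gaussian field. -/
theorem lintegral_exp_mul_eq (hGauss : IsGaussianProcess W P) (hCentred : ∀ x, ∫ ω, W x ω ∂P = 0)
    (x : Space d) (t : ℝ) :
    ∫⁻ ω, ENNReal.ofReal (Real.exp (t * W x ω)) ∂P =
      ENNReal.ofReal (Real.exp (fieldVariance W P x * t ^ 2 / 2)) := by
  have hlaw := (hGauss.hasGaussianLaw_eval x).map_eq_gaussianReal
  have hmgf := mgf_gaussianReal hlaw t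
  have hint : Integrable (fun ω => Real.exp (t * W x ω)) P := by
    have := hGauss.isProbabilityMeasure
    rw [← mgf_pos_iff, hmgf]
    positivity
  rw [← ofReal_integral_eq_lintegral_ofReal hint (ae_of_all _ fun ω => (Real.exp_pos _).le)]
  rw [mgf, hCentred x, zero_mul, zero_add, Real.coe_toNNReal _ (variance_nonneg _ _)] at hmgf
  rw [hmgf]
  rfl

theorem outerExpectation_le_lintegral {f g : Ω → ℝ≥0∞} (hg : AEMeasurable g P)
    (hfg : ∀ᵐ ω ∂P, f ω ≤ g ω) : outerExpectation P f ≤ ∫⁻ ω, g ω ∂P := by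
  rw [← outerExpectation_eq_lintegral P g hg]
  refine le_iInf fun u => le_iInf fun hu => le_iInf fun hgu => ?_
  exact iInf₂_le_of_le u hu (iInf_le _ (hfg.mp (hgu.mono fun ω h1 h2 => h2.trans h1)))

/-- The first variance condition keeps the variance on `[h, h + 1]` above a fixed proportion of
its value at `h`. -/
theorem eventually_fieldVariance_ge
    (hVar₁ : (fun h : Fin d → ℤ =>
        ⨆ x : unitCube (0 : Fin d → ℤ),
          (fieldVariance W P (latticePoint h) - fieldVariance W P ((x : Space d) + latticePoint h)))
      =o[latticeAtInfinity d] fun h => fieldVariance W P (latticePoint h)) :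
    ∀ᶠ h in latticeAtInfinity d, ∀ x ∈ unitCube h,
      3 / 4 * fieldVariance W P (latticePoint h) ≤ fieldVariance W P x := by
  filter_upwards [hVar₁.bound (c := 1 / 4) (by norm_num)] with h hh x hx
  have hnn (y : Space d) : 0 ≤ fieldVariance W P y := variance_nonneg _ _
  -- The supremum is a genuine one: its terms are bounded above by `σ_W²(h)`.
  have hbdd : BddAbove (Set.range fun x : unitCube (0 : Fin d → ℤ) =>
      fieldVariance W P (latticePoint h) - fieldVariance W P ((x : Space d) + latticePoint h)) := by
    refine ⟨fieldVariance W P (latticePoint h), ?_⟩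
    rintro _ ⟨y, rfl⟩
    exact sub_le_self _ (hnn _)
  have h1 := le_ciSup hbdd ⟨_, sub_latticePoint_mem_unitCube hx⟩
  simp only [sub_add_cancel] at h1
  rw [Real.norm_of_nonneg (hnn _)] at hh
  have h2 := (le_abs_self _).trans hh
  linarith

/-- The pathwise estimate, with `p` and `q` the suprema over the near and the far cube and `exp w`
the factor of `q` that depends on the corner value alone. Either `exp w ≤ r`, and `q ≤ r A'`; or
`exp w > r`, and the factor `(exp w / r) ^ (1 / 2) ≥ 1` may be inserted into the constant part of
the bound on `p`. -/
theorem min_le_of_le_mul {p q A A' : ℝ≥0∞} {r δ s w : ℝ} (hδ : 0 < δ)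
    (hp : p ≤ ENNReal.ofReal δ * A + ENNReal.ofReal δ⁻¹)
    (hq : q ≤ ENNReal.ofReal (Real.exp w) * A') (hs : Real.exp (2 * s) = r) :
    min p q ≤ ENNReal.ofReal r * A' + ENNReal.ofReal δ * A +
      ENNReal.ofReal (δ⁻¹ * Real.exp (w / 2 - s)) := by
  rcases le_or_gt (Real.exp w) r with hw | hw
  · refine (min_le_right _ _).trans (hq.trans ?_)
    rw [add_assoc]
    exact le_add_right (by gcongr)
  · refine (min_le_left _ _).trans (hp.trans ?_)
    rw [add_assoc]
    refine le_add_left ?_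
    gcongr
    refine le_mul_of_one_le_right (by positivity) (Real.one_le_exp ?_)
    rw [← hs, Real.exp_lt_exp] at hw
    linarith

/-- The supremum over the unit cube. The variance term only helps and is dropped; the inequality
`e ≤ δ e² + δ⁻¹` leaves an arbitrarily small multiple of the exponential supremum. -/
theorem fieldSup_unitCube_zero_le {ω : Ω} (hω0 : W 0 ω = 0) {A : ℝ≥0∞}
    (hA : ∀ x ∈ unitCube (0 : Fin d → ℤ),
      ENNReal.ofReal (Real.exp (2 * |W x ω - W (latticePoint 0) ω|)) ≤ A)
    {δ : ℝ} (hδ : 0 < δ) :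
    fieldSup (brownResnickSpectral W P) (unitCube 0) ω ≤
      ENNReal.ofReal δ * A + ENNReal.ofReal δ⁻¹ := by
  refine iSup₂_le fun x hx => ?_
  have hAx := hA x hx
  rw [latticePoint_zero, hω0, sub_zero] at hAx
  have hv : 0 ≤ fieldVariance W P x := variance_nonneg _ _
  have h1 : brownResnickSpectral W P x ω ≤ Real.exp |W x ω| :=
    Real.exp_le_exp.2 (by linarith [le_abs_self (W x ω)])
  -- The inequality `e ≤ δ e² + δ⁻¹`, from `δ⁻¹ (δ e - 1)² ≥ 0`.
  have h2 : Real.exp |W x ω| ≤ δ * Real.exp (2 * |W x ω|) + δ⁻¹ := by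
    have h3 : Real.exp (2 * |W x ω|) = Real.exp |W x ω| ^ 2 := by
      rw [← Real.exp_nat_mul]; norm_num
    have h4 : 0 ≤ δ⁻¹ * (δ * Real.exp |W x ω| - 1) ^ 2 := by positivity
    have h5 : δ⁻¹ * (δ * Real.exp |W x ω| - 1) ^ 2 =
        δ * Real.exp |W x ω| ^ 2 + δ⁻¹ - 2 * Real.exp |W x ω| := by
      field_simp
      ring
    rw [h3]
    linarith [Real.exp_pos |W x ω|]
  calc ENNReal.ofReal (brownResnickSpectral W P x ω)
      ≤ ENNReal.ofReal (δ * Real.exp (2 * |W x ω|) + δ⁻¹) := by gcongr; exact h1.trans h2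
    _ = ENNReal.ofReal δ * ENNReal.ofReal (Real.exp (2 * |W x ω|)) + ENNReal.ofReal δ⁻¹ := by
        rw [ENNReal.ofReal_add (by positivity) (by positivity), ENNReal.ofReal_mul hδ.le]
    _ ≤ _ := by gcongr

theorem fieldSup_unitCube_le {ω : Ω} {h : Fin d → ℤ} {A : ℝ≥0∞}
    (hA : ∀ x ∈ unitCube h,
      ENNReal.ofReal (Real.exp (2 * |W x ω - W (latticePoint h) ω|)) ≤ A)
    {m : ℝ} (hm : ∀ x ∈ unitCube h, m ≤ fieldVariance W P x) :
    fieldSup (brownResnickSpectral W P) (unitCube h) ω ≤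
      ENNReal.ofReal (Real.exp (W (latticePoint h) ω - m / 2)) * A := by
  refine iSup₂_le fun x hx => ?_
  refine le_trans ?_ (mul_le_mul_right (hA x hx) _)
  rw [← ENNReal.ofReal_mul (Real.exp_pos _).le, ← Real.exp_add]
  refine ENNReal.ofReal_le_ofReal (Real.exp_le_exp.2 ?_)
  linarith [hm x hx, le_abs_self (W x ω - W (latticePoint h) ω),
    abs_nonneg (W x ω - W (latticePoint h) ω)]

/-- The expectation of the pathwise bound of `min_le_of_le_mul`, for `r = δ = exp (-σ²(h) / 64)`:
with these thresholds each of its three terms is of order at most `exp (-σ²(h) / 64)`. -/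
theorem lintegral_threshold_bound_le (hGauss : IsGaussianProcess W P)
    (hCentred : ∀ x, ∫ ω, W x ω ∂P = 0) {A A' : Ω → ℝ≥0∞} (hAm : AEMeasurable A P)
    (hAm' : AEMeasurable A' P) {M : ℝ} (hM : 0 ≤ M) (hA : ∫⁻ ω, A ω ∂P = ENNReal.ofReal M)
    (hA' : ∫⁻ ω, A' ω ∂P = ENNReal.ofReal M) {x : Space d} {v : ℝ} (hv : v = fieldVariance W P x)
    {r : ℝ} (hr : r = Real.exp (-v / 64)) :
    ∫⁻ ω, (ENNReal.ofReal r * A' ω + ENNReal.ofReal r * A ω +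
      ENNReal.ofReal (Real.exp (-21 * v / 128)) *
        ENNReal.ofReal (Real.exp (1 / 2 * W x ω))) ∂P ≤ ENNReal.ofReal (r * (2 * M + 1)) := by
  have hvnn : 0 ≤ v := hv ▸ variance_nonneg _ _
  have hrpos : 0 < r := hr ▸ Real.exp_pos _
  have hexp : Real.exp (-21 * v / 128) * Real.exp (v * (1 / 2) ^ 2 / 2) ≤ r := by
    rw [← Real.exp_add, hr]
    exact Real.exp_le_exp.2 (by linarith)
  have hsum : AEMeasurable (fun ω => ENNReal.ofReal r * A' ω + ENNReal.ofReal r * A ω) P :=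
    (hAm'.const_mul _).add (hAm.const_mul _)
  rw [lintegral_add_left' hsum, lintegral_add_left' (hAm'.const_mul _),
    lintegral_const_mul'' _ hAm',
    lintegral_const_mul'' _ hAm, lintegral_const_mul' _ _ ENNReal.ofReal_ne_top,
    hA, hA', lintegral_exp_mul_eq hGauss hCentred, ← hv,
    ← ENNReal.ofReal_mul hrpos.le, ← ENNReal.ofReal_mul (Real.exp_pos _).le,
    ← ENNReal.ofReal_add (by positivity) (by positivity),
    ← ENNReal.ofReal_add (by positivity) (by positivity)]
  exact ENNReal.ofReal_le_ofReal (by linarith)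

/-- The expected minimum decays exponentially in `σ_W²(h)`, wherever the variance stays above three
quarters of `σ_W²(h)` on the far cube, and it is bounded uniformly in `h` without this
restriction. -/
theorem exists_outerExpectation_min_le [IsProbabilityMeasure P]
    (hGauss : IsGaussianProcess W P) (hCentred : ∀ x, ∫ ω, W x ω ∂P = 0)
    (hIncr : HasStationaryIncrements W P) (hZero : ∀ᵐ ω ∂P, W 0 ω = 0)
    (hSep : IsSeparableField W P)
    (hBdd : ∀ᵐ ω ∂P, ∃ M : ℝ, ∀ x ∈ unitCube (0 : Fin d → ℤ), |W x ω| ≤ M) :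
    ∃ M : ℝ, 0 ≤ M ∧
      (∀ h : Fin d → ℤ, outerExpectation P (fun ω =>
        min (fieldSup (brownResnickSpectral W P) (unitCube 0) ω)
          (fieldSup (brownResnickSpectral W P) (unitCube h) ω)) ≤ ENNReal.ofReal (2 * M + 1)) ∧
      ∀ h : Fin d → ℤ,
        (∀ x ∈ unitCube h, 3 / 4 * fieldVariance W P (latticePoint h) ≤ fieldVariance W P x) →
        outerExpectation P (fun ω =>
          min (fieldSup (brownResnickSpectral W P) (unitCube 0) ω)
            (fieldSup (brownResnickSpectral W P) (unitCube h) ω)) ≤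
          ENNReal.ofReal (Real.exp (-fieldVariance W P (latticePoint h) / 64) * (2 * M + 1)) := by
  have hm (x : Space d) : AEMeasurable (W x) P := hGauss.aemeasurable x
  obtain ⟨D, hDc, hD, hsep⟩ := hSep.exists_invariant
  set S : Set (Space d) := D ∩ bigCube d
  have hS : S.Countable := hDc.mono Set.inter_subset_left
  have := hS.to_subtype
  set A : (Fin d → ℤ) → Ω → ℝ≥0∞ := fun h ω =>
    expSup (fun q : S => W (q + latticePoint h) ω - W (latticePoint h) ω)
  have hAm (h : Fin d → ℤ) : AEMeasurable (A h) P :=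
    measurable_expSup.comp_aemeasurable (aemeasurable_pi_lambda _ fun q => (hm _).sub (hm _))
  have hfin : ∫⁻ ω, expSup (fun q : S => W q ω) ∂P < ∞ :=
    lintegral_expSup_lt_top (hGauss.comp_right (Subtype.val : S → Space d)) (fun q => hCentred q)
      (ae_exists_bound_bigCube hIncr hm hZero hBdd hDc hD)
  set M : ℝ := (∫⁻ ω, expSup (fun q : S => W q ω) ∂P).toReal with hMdef
  have hMnn : 0 ≤ M := ENNReal.toReal_nonneg
  have hAint (h : Fin d → ℤ) : ∫⁻ ω, A h ω ∂P = ENNReal.ofReal M := by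
    rw [hMdef, ENNReal.ofReal_toReal hfin.ne]
    exact ((hIncr.identDistrib hm hZero (latticePoint h) hS).comp measurable_expSup).lintegral_eq
  refine ⟨M, hMnn, fun h => ?_, fun h hv => ?_⟩
  · calc _ ≤ ∫⁻ ω, (A 0 ω + 1) ∂P := by
          refine outerExpectation_le_lintegral ((hAm 0).add_const 1) ?_
          filter_upwards [hsep, hZero] with ω hω hω0
          refine (min_le_left _ _).trans ?_
          simpa using fieldSup_unitCube_zero_le (P := P) hω0
            (fun x hx => ofReal_exp_le_expSup_of_separated hD hω 0 hx) one_pos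
      _ = ENNReal.ofReal (M + 1) := by
          rw [lintegral_add_right _ measurable_const, hAint, lintegral_const, measure_univ,
            mul_one, ENNReal.ofReal_add hMnn zero_le_one, ENNReal.ofReal_one]
      _ ≤ ENNReal.ofReal (2 * M + 1) := by gcongr; linarith
  · set v := fieldVariance W P (latticePoint h) with hvdef
    set r : ℝ := Real.exp (-v / 64) with hr
    have hrpos : 0 < r := Real.exp_pos _
    have hrest (t : ℝ) : r⁻¹ * Real.exp ((t - 3 / 4 * v / 2) / 2 - -v / 128) =
        Real.exp (-21 * v / 128) * Real.exp (1 / 2 * t) := by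
      rw [hr, ← Real.exp_neg, ← Real.exp_add, ← Real.exp_add]
      congr 1
      ring
    have hsq : Real.exp (2 * (-v / 128)) = r := by
      rw [hr]
      congr 1
      ring
    refine le_trans (outerExpectation_le_lintegral ?_ ?_) (lintegral_threshold_bound_le hGauss
      hCentred (hAm 0) (hAm h) hMnn (hAint 0) (hAint h) hvdef hr)
    · have := hm (latticePoint h)
      have := hAm h
      have := hAm 0
      fun_prop
    · filter_upwards [hsep, hZero] with ω hω hω0
      have hp := fieldSup_unitCube_zero_le (P := P) (W := W) hω0 (A := A 0 ω)
        (fun x hx => ofReal_exp_le_expSup_of_separated hD hω 0 hx) hrpos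
      have hq := fieldSup_unitCube_le (P := P) (W := W) (A := A h ω)
        (fun x hx => ofReal_exp_le_expSup_of_separated hD hω h hx) hv
      have hmin := min_le_of_le_mul hrpos hp hq hsq
      rwa [hrest, ENNReal.ofReal_mul (Real.exp_pos _).le] at hmin

end Field

/-! ### Polynomial decay -/

theorem mainTheorem5 {Ω : Type*} [MeasurableSpace Ω] (P : Measure Ω) [IsProbabilityMeasure P]
    (d : ℕ) (hd : 1 ≤ d) (W : Space d → Ω → ℝ)
    (hGauss : IsGaussianProcess W P)
    (hCentred : ∀ x, ∫ ω, W x ω ∂P = 0)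
    (hIncr : HasStationaryIncrements W P)
    (hZero : ∀ᵐ ω ∂P, W 0 ω = 0)
    (hSep : IsSeparableField W P)
    (hBdd : ∀ᵐ ω ∂P, ∃ M : ℝ, ∀ x ∈ unitCube (0 : Fin d → ℤ), |W x ω| ≤ M)
    (hVar₁ : (fun h : Fin d → ℤ =>
        ⨆ x : unitCube (0 : Fin d → ℤ),
          (fieldVariance W P (latticePoint h) - fieldVariance W P ((x : Space d) + latticePoint h)))
      =o[latticeAtInfinity d] fun h => fieldVariance W P (latticePoint h))
    (hVar₂ : Tendsto
      (fun h : Fin d → ℤ => fieldVariance W P (latticePoint h) / Real.log ‖latticePoint h‖)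
      (latticeAtInfinity d) atTop) :
    ∀ b : ℝ, 0 < b → SatisfiesDecay (brownResnickSpectral W P) P b := by
  intro b hb
  obtain ⟨M, hM, hall, hlarge⟩ :=
    exists_outerExpectation_min_le hGauss hCentred hIncr hZero hSep hBdd
  have hev := (eventually_fieldVariance_ge hVar₁).and (hVar₂.eventually_ge_atTop (64 * b))
  obtain ⟨R, -, hR⟩ :=
    (atTop_basis.comap fun h : Fin d → ℤ => ‖latticePoint h‖).eventually_iff.1 hev
  set R' : ℝ := max R 2
  have hR' : 1 ≤ R' ^ b := Real.one_le_rpow (by linarith [le_max_right R 2]) hb.le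
  refine ⟨(2 * M + 1) * R' ^ b, by positivity, fun h hh => ?_⟩
  have h1 := one_le_norm_latticePoint hh
  -- Near the origin the uniform bound suffices, since there `‖h‖ ^ (-b) ≥ R' ^ (-b)`.
  rcases lt_or_ge ‖latticePoint h‖ R' with hlt | hge
  · refine (hall h).trans (ENNReal.ofReal_le_ofReal ?_)
    have h2 : 1 ≤ R' ^ b * ‖latticePoint h‖ ^ (-b) := by
      rw [Real.rpow_neg (by positivity), ← div_eq_mul_inv, one_le_div (by positivity)]
      gcongr
    rw [mul_assoc]
    exact le_mul_of_one_le_right (by positivity) h2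
  · obtain ⟨hv, hlog⟩ := hR (show R ≤ ‖latticePoint h‖ from (le_max_left _ _).trans hge)
    refine (hlarge h hv).trans (ENNReal.ofReal_le_ofReal ?_)
    have hlogpos : 0 < Real.log ‖latticePoint h‖ :=
      Real.log_pos (by linarith [le_max_right R 2])
    rw [le_div_iff₀ hlogpos] at hlog
    have h2 : Real.exp (-fieldVariance W P (latticePoint h) / 64) ≤ ‖latticePoint h‖ ^ (-b) := by
      rw [Real.rpow_def_of_pos (by linarith)]
      exact Real.exp_le_exp.2 (by linarith)
    calc _ ≤ ‖latticePoint h‖ ^ (-b) * (2 * M + 1) := by gcongr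
      _ = (2 * M + 1) * 1 * ‖latticePoint h‖ ^ (-b) := by ring
      _ ≤ (2 * M + 1) * R' ^ b * ‖latticePoint h‖ ^ (-b) := by gcongr
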